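/- Let $\varepsilon,\delta\in(0,1)$ be constants. Consider the 3-chain query $\mathcal Q(\mathcal R)=\pi_{A,D}\,R_1(A,B)\bowtie R_2(B,C)\bowtie R_3(C,D)$, i.e. the set of pairs $(a,d)$ for which there are $b,c$ with $(a,b)\in R_1$, $(b,c)\in R_2$, $(c,d)\in R_3$. For an instance $\mathcal R=(R_1,R_2,R_3)$ the input size is $|R_1|+|R_2|+|R_3|$ and the output size is $|\mathcal Q(\mathcal R)|$. In the property-testing model, a randomized algorithm reaches the instance only through the following primitives, for a relation $R_e$ with attribute set $e$: (sample tuple) a uniform random tuple of $R_e$; (compute degree) for a tuple $t$ on attributes $e'\subseteq e$, the number $|R_e\ltimes t|$ of tuples of $R_e$ that agree with $t$ on $e'$; (access neighbor) for such a $t$ and an integer $j$, the $j$-th tuple of $\pi_{e-e'}(R_e\ltimes t)$ in increasing lexicographic order; (test tuple) whether a given tuple belongs to $R_e$. Each primitive call, each step of internal (possibly randomized) computation, and the output of the estimate cost one unit of time; what an internal step may compute is not restricted. A number $v$ is an $\varepsilon$-approximation of $V$ if $(1-\varepsilon)V\le v\le(1+\varepsilon)V$. There are constants $c>0$ and $K\in\mathbb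 N$ depending only on $\varepsilon$ and $\delta$ such that the following holds. Let $N,\mathrm{OUT}\in\mathbb Z^+$, and let $D\ge N$ be such that some instance with attribute values in a fixed ordered set of $D$ values has input size $N$ and output size $\mathrm{OUT}$. Let $\mathcal A$ be a randomized algorithm in the property-testing model (which may depend on $N,\mathrm{OUT},D$) that, on every instance $\mathcal R$ over these $D$ values with input size $N$ and $\mathrm{OUT}\le|\mathcal Q(\mathcal R)|\le K\cdot\mathrm{OUT}$, returns an $\varepsilon$-approximation of $|\mathcal Q(\mathcal R)|$ with probability at least $1-\delta$. Then there is an instance over these $D$ values, of input size exactly $N$ and output size exactly $\mathrm{OUT}$, on which with probability at least $c$ the running time of $\mathcal A$ is at least $$c\cdot\min\Big\{N,\ \frac{N^2}{\mathrm{OUT}}\Big\}.$$ In particular, the worst-case and the expected running time of $\mathcal A$ on instances of input size $N$ and output size $\mathrm{OUT}$ are $\Omega(\min\{N,N^2/\mathrm{OUT}\})$. -/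

import Mathlib

open scoped ENNReal

namespace ChainCount

/-- A binary tuple over the integer-encoded domain `[D]`. -/
abbrev Tuple (D : ℕ) : Type := Fin D × Fin D

/-- A tuple `t` on a subset `e'` of the two attributes of a binary relation:
`none` at a component means that this attribute is not in `e'`. -/
abbrev PartialTuple (D : ℕ) : Type := Option (Fin D) × Option (Fin D)

/-- The tuple `p` agrees with `t` on the attributes on which `t` is defined. -/
def Matches {D : ℕ} (t : PartialTuple D) (p : Tuple D) : Prop :=
  (∀ x ∈ t.1, p.1 = x) ∧ (∀ y ∈ t.2, p.2 = y)

/-- An instance of the 3-chain query: relations `rel 0 = R₁(A, B)`, `rel 1 = R₂(B, C)` and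
`rel 2 = R₃(C, D)`, each a finite set of tuples. -/
structure Instance (D : ℕ) where
  rel : Fin 3 → Finset (Tuple D)

namespace Instance

variable {D : ℕ}

/-- The input size: the total number of tuples. -/
def inputSize (I : Instance D) : ℕ := ∑ e, (I.rel e).card

open scoped Classical in
/-- The result of `π_{A,D} R₁(A,B) ⋈ R₂(B,C) ⋈ R₃(C,D)`. -/
noncomputable def queryResult (I : Instance D) : Finset (Tuple D) :=
  Finset.univ.filter fun p =>
    ∃ b c : Fin D, (p.1, b) ∈ I.rel 0 ∧ (b, c) ∈ I.rel 1 ∧ (c, p.2) ∈ I.rel 2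

/-- The output size `OUT`. -/
noncomputable def outputSize (I : Instance D) : ℕ := I.queryResult.card

open scoped Classical in
/-- The semijoin `R_e ⋉ t`. -/
noncomputable def semijoin (I : Instance D) (e : Fin 3) (t : PartialTuple D) :
    Finset (Tuple D) :=
  (I.rel e).filter (Matches t)

/-- The primitive "sample tuple": a uniform sample from `R_e` (`none` if `R_e` is empty). -/
noncomputable def sampleTuple (I : Instance D) (e : Fin 3) : PMF (Option (Tuple D)) :=
  open scoped Classical in
  if h : (I.rel e).Nonempty then (PMF.uniformOfFinset (I.rel e) h).map some else PMF.pure none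

/-- The primitive "compute degree": `|R_e ⋉ t|`. -/
noncomputable def degree (I : Instance D) (e : Fin 3) (t : PartialTuple D) : ℕ :=
  (I.semijoin e t).card

/-- The primitive "access neighbor": the `j`-th tuple (counted from `0`) of `R_e ⋉ t` in
increasing lexicographic order, `none` if there is none. On the attributes `e'` of `t` the answer
repeats `t`; on the remaining attributes it is the `j`-th tuple of `π_{e - e'} (R_e ⋉ t)`. -/
noncomputable def neighbor (I : Instance D) (e : Fin 3) (t : PartialTuple D) (j : ℕ) :
    Option (Tuple D) :=
  ((((I.semijoin e t).map (toLex : Tuple D ≃ Fin D ×ₗ Fin D).toEmbedding).sort)[j]?).map ofLex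

/-- The primitive "test tuple": whether `p ∈ R_e`. -/
def test (I : Instance D) (e : Fin 3) (p : Tuple D) : Bool := decide (p ∈ I.rel e)

end Instance

/-- What an algorithm with state space `σ` does in one time unit: stop and return an estimate,
make one step of (possibly randomized) internal computation, or call one primitive and continue
in a state that depends on the answer. -/
inductive Action (D : ℕ) (σ : Type) : Type
  | output (v : ℝ)
  | compute (μ : PMF σ)
  | sampleTuple (e : Fin 3) (k : Option (Tuple D) → σ)
  | computeDegree (e : Fin 3) (t : PartialTuple D) (k : ℕ → σ)
  | accessNeighbor (e : Fin 3) (t : PartialTuple D) (j : ℕ) (k : Option (Tuple D) → σ)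
  | testTuple (e : Fin 3) (p : Tuple D) (k : Bool → σ)

/-- A randomized algorithm in the property-testing model, which reaches the instance only through
the primitives. States are arbitrary (for a word RAM program: memory and program counter), and an
internal step may be any randomized map of states; a word RAM instruction, `RandInt` included, is
such a step. -/
structure Algorithm (D : ℕ) : Type 1 where
  State : Type
  init : State
  act : State → Action D State

namespace Algorithm

variable {D : ℕ}

/-- The result of at most `t` time units from the state `s` on the instance `I`:
`some v` if the algorithm has stopped and returned `v`, `none` if it is still running. -/
noncomputable def runFrom (𝒜 : Algorithm D) (I : Instance D) : ℕ → 𝒜.State → PMF (Option ℝ)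
  | 0, _ => PMF.pure none
  | t + 1, s =>
    match 𝒜.act s with
    | .output v => PMF.pure (some v)
    | .compute μ => μ.bind fun s' => 𝒜.runFrom I t s'
    | .sampleTuple e k => (I.sampleTuple e).bind fun a => 𝒜.runFrom I t (k a)
    | .computeDegree e x k => 𝒜.runFrom I t (k (I.degree e x))
    | .accessNeighbor e x j k => 𝒜.runFrom I t (k (I.neighbor e x j))
    | .testTuple e p k => 𝒜.runFrom I t (k (I.test e p))

/-- The distribution of the result of the first `t` time units on `I`. -/
noncomputable def run (𝒜 : Algorithm D) (I : Instance D) (t : ℕ) : PMF (Option ℝ) :=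
  𝒜.runFrom I t 𝒜.init

/-- `Pr[the running time on I exceeds t]`. -/
noncomputable def probRunningAfter (𝒜 : Algorithm D) (I : Instance D) (t : ℕ) : ℝ≥0∞ :=
  𝒜.run I t none

end Algorithm

/-- `v` is an `ε`-approximation of `V`. -/
def IsApprox (ε V v : ℝ) : Prop := (1 - ε) * V ≤ v ∧ v ≤ (1 + ε) * V

/-- The probability that `𝒜` on `I` ever stops and returns an `ε`-approximation of the output
size: the limit (a supremum, by monotonicity) of the probabilities of doing so within `t` steps. -/
noncomputable def Algorithm.successProb {D : ℕ} (𝒜 : Algorithm D) (I : Instance D) (ε : ℝ) :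
    ℝ≥0∞ :=
  ⨆ t : ℕ, (𝒜.run I t).toOuterMeasure {r | ∃ v : ℝ, r = some v ∧ IsApprox ε I.outputSize v}

end ChainCount

/-! The bound comes from switches hidden in `R₂`. The values `2 * j` and `2 * j + 1` of `C` have the
partners `0` and `j + 1`, and switch `j` exchanges these two. Degrees of single values do not
change, and in lexicographic order only the tuples at positions `j` and `m + j` change, so the
answer to any deterministic query depends on at most one switch. Sampling is a neighbor query at a
uniform position (`sampleTuple_eq`), so it reveals no more. Yet a switch `j > 0` joins the `p`
values of `A` at `0` to the `q` values of `D` behind `2 * j + 1`, which adds `p * q ≥ OUT / 2`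
results.

There is room for `n = Ω(min {N, N² / OUT})` switches (`exists_parameters`). Cut them into `S = n /
h` disjoint blocks of size `h`, and switch on one block at a time. By a hybrid argument
(`sum_runFrom_le`), `t` steps separate the switchless instance from these `S` instances by a total
of at most `t` in probability. Put `4 * η = 1 - δ`. If `t ≤ η * S` and the algorithm is still
running on the switchless instance with probability at most `η`, then on that instance it returns an
approximation of `OUT + p * q * h` with probability at least `2 * η` (`le_approx_hardInstance`).

Since `δ` may exceed `1 / 2`, two competing output sizes do not suffice. The sizes `h = B ^ i` for
`i < M` have pairwise disjoint approximation events if `B` is large, and `2 * η * M > 1` is then a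
contradiction. -/

namespace ChainCount

/-! ### Sampling as access to a random position -/

/-- The uniform distribution on `{0, …, n - 1}`, and the point mass at `0` if `n = 0`. -/
noncomputable def uniformIndex (n : ℕ) : PMF ℕ :=
  -- In an empty relation position `0` holds no tuple, so the point mass at `0` reproduces the
  -- answer `none` of a sample.
  if h : (Finset.range n).Nonempty then PMF.uniformOfFinset (Finset.range n) h else PMF.pure 0

theorem uniformOfFinset_map_some_eq {α : Type*} [LinearOrder α] (s : Finset α)
    (h : s.Nonempty) :
    (PMF.uniformOfFinset s h).map some = (uniformIndex s.card).map (fun j => s.sort[j]?) := by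
  have hn : (Finset.range s.card).Nonempty := by simpa using h.card_ne_zero
  ext x
  rw [uniformIndex, dif_pos hn, PMF.map_apply, PMF.map_apply,
    tsum_eq_sum (s := s), tsum_eq_sum (s := Finset.range s.card)]
  · symm
    refine Finset.sum_bij
      (fun j hj => s.orderEmbOfFin rfl ⟨j, Finset.mem_range.1 hj⟩) ?_ ?_ ?_ ?_
    · intro j hj
      exact Finset.orderEmbOfFin_mem _ _ _
    · intro j hj j' hj' hjj
      simpa using hjj
    · intro a ha
      have : a ∈ Set.range (s.orderEmbOfFin rfl) := by
        rw [Finset.range_orderEmbOfFin]; exact ha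
      obtain ⟨j, hj⟩ := this
      exact ⟨j, by simp, hj⟩
    · intro j hj
      have hj' : j < s.sort.length := by simpa using hj
      rw [PMF.uniformOfFinset_apply_of_mem _ hj,
        PMF.uniformOfFinset_apply_of_mem _ (Finset.orderEmbOfFin_mem _ _ _),
        Finset.orderEmbOfFin_apply, Finset.card_range, List.getElem?_eq_getElem hj']
      rfl
  · intro j hj
    rw [PMF.uniformOfFinset_apply_of_notMem _ hj, ite_self]
  · intro j hj
    rw [PMF.uniformOfFinset_apply_of_notMem _ hj, ite_self]

namespace Instance

variable {D : ℕ}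

theorem semijoin_none (I : Instance D) (e : Fin 3) : I.semijoin e (none, none) = I.rel e := by
  ext p
  simp [semijoin, Matches]

theorem degree_none (I : Instance D) (e : Fin 3) : I.degree e (none, none) = (I.rel e).card := by
  rw [degree, semijoin_none]

/-- A uniform sample is the tuple at a uniform position of the sorted relation. -/
theorem sampleTuple_eq (I : Instance D) (e : Fin 3) :
    I.sampleTuple e =
      (uniformIndex (I.degree e (none, none))).map (I.neighbor e (none, none)) := by
  unfold sampleTuple neighbor
  rw [degree_none, semijoin_none]
  split_ifs with h
  · set s := (I.rel e).map (toLex : Tuple D ≃ Fin D ×ₗ Fin D).toEmbedding with hs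
    have hsn : s.Nonempty := by simpa [hs] using h
    have key := uniformOfFinset_map_some_eq s hsn
    have hc : s.card = (I.rel e).card := Finset.card_map _
    have hu : (PMF.uniformOfFinset s hsn).map ofLex = PMF.uniformOfFinset (I.rel e) h := by
      ext x
      rw [PMF.map_apply, tsum_eq_single (toLex x)]
      · by_cases hx : x ∈ I.rel e
        · have : toLex x ∈ s := by simp [hs, hx]
          rw [PMF.uniformOfFinset_apply_of_mem _ hx, PMF.uniformOfFinset_apply_of_mem _ this, hc]
          simp
        · have : toLex x ∉ s := by simp [hs, hx]
          rw [PMF.uniformOfFinset_apply_of_notMem _ hx,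
            PMF.uniformOfFinset_apply_of_notMem _ this]
          simp
      · intro y hy
        rw [if_neg]
        rintro rfl
        exact hy rfl
    have := congrArg (PMF.map (Option.map ofLex)) key
    rw [PMF.map_comp, PMF.map_comp, hc] at this
    rw [← hu, PMF.map_comp]
    exact this
  · rw [Finset.not_nonempty_iff_eq_empty] at h
    rw [h]
    simp [PMF.map, Function.comp_def]

/-- Every query about `J a` is answered as it is about `I`, for all indices `a` but at most one. -/
structure AlmostAgree {ι : Type*} (I : Instance D) (J : ι → Instance D) : Prop where
  degree : ∀ e t, {a | (J a).degree e t ≠ I.degree e t}.Subsingleton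
  card : ∀ a e, (J a).degree e (none, none) = I.degree e (none, none)
  neighbor : ∀ e t j, {a | (J a).neighbor e t j ≠ I.neighbor e t j}.Subsingleton
  test : ∀ e p, {a | (J a).test e p ≠ I.test e p}.Subsingleton

end Instance

/-! ### The hybrid argument -/

/-- Only one index can have a deviating answer, and its term is at most `1`. This is the price of
one query. -/
theorem sum_le_sum_add_one {ι β : Type*} [Fintype ι] {x : ι → β} {y : β}
    (h : {a | x a ≠ y}.Subsingleton) (f : ι → β → ℝ≥0∞) (hf : ∀ a b, f a b ≤ 1) :
    ∑ a, f a (x a) ≤ ∑ a, f a y + 1 := by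
  classical
  by_cases hex : ∃ a, x a ≠ y
  · obtain ⟨a₀, ha₀⟩ := hex
    rw [← Finset.add_sum_erase _ _ (Finset.mem_univ a₀), add_comm]
    refine add_le_add ?_ (hf _ _)
    calc ∑ a ∈ Finset.univ.erase a₀, f a (x a) = ∑ a ∈ Finset.univ.erase a₀, f a y := by
          refine Finset.sum_congr rfl fun a ha => ?_
          by_cases hxa : x a = y
          · rw [hxa]
          · exact absurd (h hxa ha₀) (Finset.ne_of_mem_erase ha)
      _ ≤ ∑ a, f a y := Finset.sum_le_sum_of_subset (Finset.erase_subset _ _)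
  · push Not at hex
    simp [hex]

theorem toOuterMeasure_le_one {α : Type*} (p : PMF α) (E : Set α) : p.toOuterMeasure E ≤ 1 := by
  rw [PMF.toOuterMeasure_apply, ← p.tsum_coe]
  exact ENNReal.tsum_le_tsum fun x => Set.indicator_le_self' (fun _ _ => zero_le) x

theorem sum_toOuterMeasure_bind_le {ι α γ : Type*} [Fintype ι] (μ : PMF α)
    (f : ι → α → PMF γ) (g : α → PMF γ) (E : Set γ) (c T : ℝ≥0∞)
    (h : ∀ x, ∑ a, (f a x).toOuterMeasure E ≤ c * (g x).toOuterMeasure E + T) :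
    ∑ a, (μ.bind (f a)).toOuterMeasure E ≤ c * (μ.bind g).toOuterMeasure E + T := by
  simp only [PMF.toOuterMeasure_bind_apply]
  rw [← Summable.tsum_finsetSum fun _ _ => ENNReal.summable]
  calc ∑' x, ∑ a, μ x * (f a x).toOuterMeasure E
      ≤ ∑' x, (c * (μ x * (g x).toOuterMeasure E) + μ x * T) := by
        refine ENNReal.tsum_le_tsum fun x => ?_
        rw [← Finset.mul_sum]
        calc _ ≤ μ x * (c * (g x).toOuterMeasure E + T) := mul_le_mul_right (h x) _
          _ = _ := by ring
    _ = _ := by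
        rw [ENNReal.tsum_add, ENNReal.tsum_mul_left, ENNReal.tsum_mul_right, μ.tsum_coe, one_mul]

namespace Algorithm

variable {D : ℕ} (𝒜 : Algorithm D)

/-- Hybrid argument: `t` steps tell apart at most `t` of the instances `J a` from `I`. -/
theorem sum_runFrom_le {ι : Type*} [Fintype ι] {I : Instance D} {J : ι → Instance D}
    (hIJ : I.AlmostAgree J) (E : Set (Option ℝ)) (t : ℕ) (s : 𝒜.State) :
    ∑ a, (𝒜.runFrom (J a) t s).toOuterMeasure E ≤
      Fintype.card ι * (𝒜.runFrom I t s).toOuterMeasure E + t := by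
  induction t generalizing s with
  | zero => simp [runFrom]
  | succ t ih =>
    have step : ∀ {β : Type} (x : ι → β) (y : β) (_ : {a | x a ≠ y}.Subsingleton)
        (k : β → 𝒜.State),
        ∑ a, (𝒜.runFrom (J a) t (k (x a))).toOuterMeasure E ≤
          Fintype.card ι * (𝒜.runFrom I t (k y)).toOuterMeasure E + (t + 1 : ℕ) := by
      intro β x y h k
      refine (sum_le_sum_add_one h (fun a b => (𝒜.runFrom (J a) t (k b)).toOuterMeasure E)
        fun _ _ => toOuterMeasure_le_one _ _).trans ?_
      push_cast
      rw [← add_assoc]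
      exact add_le_add_left (ih _) _
    unfold runFrom
    cases 𝒜.act s with
    | output v => simp
    | compute μ =>
      refine sum_toOuterMeasure_bind_le _ _ _ _ _ _ fun x => (ih x).trans ?_
      gcongr
      simp
    | sampleTuple e k =>
      -- Equal cardinalities make the random position equally distributed in all instances. Once it
      -- is fixed, the sample is an ordinary neighbor query.
      simp only [Instance.sampleTuple_eq, hIJ.card, PMF.bind_map]
      exact sum_toOuterMeasure_bind_le _ _ _ _ _ _ fun x => step _ _ (hIJ.neighbor e _ x) k
    | computeDegree e x k => exact step _ _ (hIJ.degree e x) k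
    | accessNeighbor e x j k => exact step _ _ (hIJ.neighbor e x j) k
    | testTuple e p k => exact step _ _ (hIJ.test e p) k

theorem toOuterMeasure_bind_mono {α γ : Type*} (μ : PMF α) (f g : α → PMF γ) (E F : Set γ)
    (h : ∀ x, (f x).toOuterMeasure E ≤ (g x).toOuterMeasure F) :
    (μ.bind f).toOuterMeasure E ≤ (μ.bind g).toOuterMeasure F := by
  simp only [PMF.toOuterMeasure_bind_apply]
  exact ENNReal.tsum_le_tsum fun x => mul_le_mul_right (h x) _

/-- A result in `W` at any time is either there at time `t` or the algorithm is then running. -/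
theorem runFrom_le_insert_none (I : Instance D) (W : Set (Option ℝ)) (hW : none ∉ W)
    (t t' : ℕ) (s : 𝒜.State) :
    (𝒜.runFrom I t' s).toOuterMeasure W ≤ (𝒜.runFrom I t s).toOuterMeasure (insert none W) := by
  induction t generalizing t' s with
  | zero => simpa [runFrom] using toOuterMeasure_le_one _ _
  | succ t ih =>
    cases t' with
    | zero => simp [runFrom, hW]
    | succ t' =>
      unfold runFrom
      cases 𝒜.act s with
      | output v => exact (PMF.toOuterMeasure _).mono (Set.subset_insert _ _)
      | compute μ => exact toOuterMeasure_bind_mono _ _ _ _ _ fun x => ih _ _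
      | sampleTuple e k => exact toOuterMeasure_bind_mono _ _ _ _ _ fun x => ih _ _
      | computeDegree e x k => exact ih _ _
      | accessNeighbor e x j k => exact ih _ _
      | testTuple e p k => exact ih _ _

/-- The event of having returned an `ε`-approximation of `V`. -/
def approxEvent (ε V : ℝ) : Set (Option ℝ) := {r | ∃ v : ℝ, r = some v ∧ IsApprox ε V v}

theorem successProb_le (I : Instance D) (ε : ℝ) (t : ℕ) :
    𝒜.successProb I ε ≤
      (𝒜.run I t).toOuterMeasure (insert none (approxEvent ε I.outputSize)) :=
  iSup_le fun t' => 𝒜.runFrom_le_insert_none I (approxEvent ε I.outputSize)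
    (by simp [approxEvent]) t t' 𝒜.init

/-- If instances `J a` of output size `V` almost agree with `I` and the algorithm succeeds on them,
then on `I` it is likely to be running or to have returned an approximation of `V`. -/
theorem le_run_of_almostAgree {ι : Type*} [Fintype ι] {I : Instance D}
    {J : ι → Instance D} (hIJ : I.AlmostAgree J) {ε : ℝ} {V : ℕ} {ρ : ℝ≥0∞}
    (hV : ∀ a, (J a).outputSize = V) (hρ : ∀ a, ρ ≤ 𝒜.successProb (J a) ε) (t : ℕ) :
    Fintype.card ι * ρ ≤ Fintype.card ι *
      ((𝒜.run I t).toOuterMeasure (approxEvent ε V) + 𝒜.probRunningAfter I t) + t := by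
  calc (Fintype.card ι * ρ : ℝ≥0∞) = ∑ _a : ι, ρ := by simp
    _ ≤ ∑ a, (𝒜.run (J a) t).toOuterMeasure (insert none (approxEvent ε V)) := by
        refine Finset.sum_le_sum fun a _ => (hρ a).trans ?_
        simpa [hV a] using 𝒜.successProb_le (J a) ε t
    _ ≤ Fintype.card ι * (𝒜.run I t).toOuterMeasure (insert none (approxEvent ε V)) + t :=
        𝒜.sum_runFrom_le hIJ _ t _
    _ ≤ _ := by
        gcongr
        rw [Set.insert_eq, add_comm]
        refine (MeasureTheory.measure_union_le _ _).trans ?_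
        rw [probRunningAfter, PMF.toOuterMeasure_apply_singleton]

theorem sum_toOuterMeasure_le_one {α ι : Type*} [Fintype ι] (p : PMF α) (W : ι → Set α)
    (hW : Pairwise (Function.onFun Disjoint W)) : ∑ i, p.toOuterMeasure (W i) ≤ 1 := by
  classical
  simp only [PMF.toOuterMeasure_apply]
  rw [← Summable.tsum_finsetSum fun _ _ => ENNReal.summable, ← p.tsum_coe]
  refine ENNReal.tsum_le_tsum fun x => ?_
  by_cases hx : ∃ i, x ∈ W i
  · obtain ⟨i, hi⟩ := hx
    rw [Finset.sum_eq_single i]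
    · exact Set.indicator_le_self' (fun _ _ => zero_le) x
    · intro j _ hj
      exact Set.indicator_of_notMem (fun h => Set.disjoint_left.1 (hW hj) h hi) _
    · simp
  · push Not at hx
    simp [hx]

end Algorithm

/-! ### Relations from number pairs, and sorted semijoins -/

/-- The relation over `[D]` given by a set of pairs of numbers. -/
def ofNatPairs (D : ℕ) (Q : Finset (ℕ × ℕ)) : Finset (Tuple D) :=
  Finset.univ.filter fun p => (p.1.val, p.2.val) ∈ Q

@[simp]
theorem mem_ofNatPairs {D : ℕ} {Q : Finset (ℕ × ℕ)} {p : Tuple D} :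
    p ∈ ofNatPairs D Q ↔ (p.1.val, p.2.val) ∈ Q := by
  simp [ofNatPairs]

theorem card_ofNatPairs {D : ℕ} {Q : Finset (ℕ × ℕ)} (hQ : ∀ x ∈ Q, x.1 < D ∧ x.2 < D) :
    (ofNatPairs D Q).card = Q.card := by
  refine Finset.card_bij (fun p _ => (p.1.val, p.2.val)) (fun p hp => by simpa using hp) ?_ ?_
  · intro p _ p' _ h
    simp only [Prod.mk.injEq] at h
    exact Prod.ext (Fin.ext h.1) (Fin.ext h.2)
  · intro x hx
    exact ⟨(⟨x.1, (hQ x hx).1⟩, ⟨x.2, (hQ x hx).2⟩), by simpa using hx, rfl⟩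

namespace Instance

variable {D : ℕ}

/-- A strictly increasing list is the sorted list of its set of entries, so an explicit enumeration
answers degree and neighbor queries. -/
theorem sort_semijoin (I : Instance D) (e : Fin 3) (t : PartialTuple D) (n : ℕ)
    (g : ℕ → Tuple D) (hg : ∀ i j, i < j → j < n → toLex (g i) < toLex (g j))
    (hm : ∀ p, p ∈ I.semijoin e t ↔ ∃ i < n, g i = p) :
    ((I.semijoin e t).map (toLex : Tuple D ≃ Fin D ×ₗ Fin D).toEmbedding).sort =
      (List.range n).map fun i => toLex (g i) := by
  have hp : ((List.range n).map fun i => toLex (g i)).Pairwise (· < ·) := by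
    rw [List.pairwise_map]
    refine List.Pairwise.imp_of_mem ?_ (List.pairwise_lt_range (n := n))
    intro i j _ hj hij
    exact hg i j hij (List.mem_range.1 hj)
  rw [← (List.toFinset_sort (r := (· ≤ ·)) (hp.imp fun h => h.ne)).2 (hp.imp fun h => h.le)]
  congr 1
  ext x
  simp [hm]
  exact Iff.rfl

theorem neighbor_eq_of_enum (I : Instance D) (e : Fin 3) (t : PartialTuple D) (n : ℕ)
    (g : ℕ → Tuple D) (hg : ∀ i j, i < j → j < n → toLex (g i) < toLex (g j))
    (hm : ∀ p, p ∈ I.semijoin e t ↔ ∃ i < n, g i = p) (j : ℕ) :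
    I.neighbor e t j = if j < n then some (g j) else none := by
  rw [neighbor, sort_semijoin I e t n g hg hm]
  split_ifs with h
  · simp [h]
  · simp [not_lt.1 h]

theorem degree_eq_of_enum (I : Instance D) (e : Fin 3) (t : PartialTuple D) (n : ℕ)
    (g : ℕ → Tuple D) (hg : ∀ i j, i < j → j < n → toLex (g i) < toLex (g j))
    (hm : ∀ p, p ∈ I.semijoin e t ↔ ∃ i < n, g i = p) :
    I.degree e t = n := by
  have := congrArg List.length (sort_semijoin I e t n g hg hm)
  simpa [degree] using this

end Instance

/-! ### The hard instances: input and output size -/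

/-- The partner in `R₂` of the value `c` of `C`: the two values `2 * j` and `2 * j + 1` have the
partners `0` and `j + 1`, in exchanged order if `j ∈ H`. -/
def partner (H : Finset ℕ) (c : ℕ) : ℕ :=
  if c % 2 = 0 then (if c / 2 ∈ H then c / 2 + 1 else 0) else
    if c / 2 ∈ H then 0 else c / 2 + 1

/-- The partner in `R₃` of the value `d` of `D`. -/
def source (q d : ℕ) : ℕ :=
  -- The value `0` is attached to `c = 1`. The remaining values form blocks of length `q`: block `0`
  -- is attached to `c = 0`, and block `j > 0` to `2 * j + 1`, whose partner becomes `0` when switch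
  -- `j` is on.
  if d = 0 then 1 else if (d - 1) / q = 0 then 0 else 2 * ((d - 1) / q) + 1

/-- `R₁`: the values of `A` below `p`, `r`, `w` are joined to the values `0`, `1`, `m + 1`
of `B`. -/
def pairs₁ (p r w m : ℕ) : Finset (ℕ × ℕ) :=
  -- Partners never exceed `m`, so the `w` tuples at `m + 1` dangle and only pad the input size.
  Finset.range p ×ˢ {0} ∪ Finset.range r ×ˢ {1} ∪ Finset.range w ×ˢ {m + 1}

/-- `R₂`: the graph of `partner H` on the values of `C` below `2 * m`. -/
def pairs₂ (m : ℕ) (H : Finset ℕ) : Finset (ℕ × ℕ) :=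
  (Finset.range (2 * m)).image fun c => (partner H c, c)

/-- `R₃`: the graph of `source q` on the values of `D` up to `q * m`. -/
def pairs₃ (q m : ℕ) : Finset (ℕ × ℕ) :=
  (Finset.range (1 + q * m)).image fun d => (source q d, d)

/-- The hard instance with the set `H` of hidden switches. Without switches, only the values `0`
and `1` of `B` contribute to the output; each switch connects the `p` values of `A` below `p` with
`q` further values of `D`. -/
def hardInstance (D p r w q m : ℕ) (H : Finset ℕ) : Instance D where
  rel e := ofNatPairs D
    (match e with
      | 0 => pairs₁ p r w m
      | 1 => pairs₂ m H
      | 2 => pairs₃ q m)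

theorem partner_le {m c : ℕ} (H : Finset ℕ) (hc : c < 2 * m) : partner H c ≤ m := by
  unfold partner
  split_ifs <;> omega

theorem card_pairs₁ (p r w : ℕ) {m : ℕ} (hm : 0 < m) : (pairs₁ p r w m).card = p + r + w := by
  unfold pairs₁
  rw [Finset.card_union_of_disjoint, Finset.card_union_of_disjoint]
  · simp
  · rw [Finset.disjoint_left]
    rintro ⟨a, b⟩ h h'
    simp at h h'
    omega
  · rw [Finset.disjoint_left]
    rintro ⟨a, b⟩ h h'
    simp at h h'
    omega

theorem card_pairs₂ (m : ℕ) (H : Finset ℕ) : (pairs₂ m H).card = 2 * m := by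
  rw [pairs₂, Finset.card_image_of_injective _ fun a b h => (Prod.ext_iff.1 h).2,
    Finset.card_range]

theorem card_pairs₃ (q m : ℕ) : (pairs₃ q m).card = 1 + q * m := by
  rw [pairs₃, Finset.card_image_of_injective _ fun a b h => (Prod.ext_iff.1 h).2,
    Finset.card_range]

theorem source_lt {q m d : ℕ} (hm : 0 < m) (hd : d < 1 + q * m) : source q d < 2 * m := by
  unfold source
  split_ifs with h h'
  · omega
  · omega
  · have : (d - 1) / q < m := Nat.div_lt_of_lt_mul (by omega)
    omega

theorem inputSize_hardInstance {D p r w q m : ℕ} (H : Finset ℕ) (hm : 0 < m)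
    (hD : (p + r + w) + 2 * m + (1 + q * m) ≤ D) :
    (hardInstance D p r w q m H).inputSize = (p + r + w) + 2 * m + (1 + q * m) := by
  rw [Instance.inputSize, Fin.sum_univ_three]
  simp only [hardInstance]
  rw [card_ofNatPairs, card_ofNatPairs, card_ofNatPairs, card_pairs₁ _ _ _ hm, card_pairs₂,
    card_pairs₃]
  · rintro ⟨c, d⟩ h
    simp only [pairs₃, Finset.mem_image, Finset.mem_range, Prod.mk.injEq] at h
    obtain ⟨d, hd, rfl, rfl⟩ := h
    have := source_lt hm hd
    constructor <;> dsimp only <;> omega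
  · rintro ⟨b, c⟩ h
    simp only [pairs₂, Finset.mem_image, Finset.mem_range, Prod.mk.injEq] at h
    obtain ⟨c, hc, rfl, rfl⟩ := h
    have := partner_le H hc
    constructor <;> dsimp only <;> omega
  · rintro ⟨a, b⟩ h
    simp [pairs₁] at h
    constructor <;> dsimp only <;> omega

/-- The output of the hard instance, as pairs of numbers. -/
def outputPairs (p r q : ℕ) (H : Finset ℕ) : Finset (ℕ × ℕ) :=
  Finset.range r ×ˢ {0} ∪
    Finset.range p ×ˢ ((insert 0 H) ×ˢ Finset.range q).image fun x => 1 + (q * x.1 + x.2)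

theorem card_outputPairs (p r q : ℕ) {H : Finset ℕ} (hH : 0 ∉ H) :
    (outputPairs p r q H).card = r + p * q * (1 + H.card) := by
  rw [outputPairs, Finset.card_union_of_disjoint, Finset.card_product, Finset.card_product,
    Finset.card_image_of_injOn, Finset.card_product, Finset.card_insert_of_notMem hH]
  · simp
    ring
  · rintro ⟨j, u⟩ h ⟨j', u'⟩ h' heq
    simp only [Finset.coe_product, Set.mem_prod, Finset.mem_coe, Finset.mem_range] at h h'
    have h1 : q * j + u = q * j' + u' := by simpa using heq
    have hq : 0 < q := by omega
    have e1 : (q * j + u) / q = j := by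
      rw [Nat.mul_add_div hq, Nat.div_eq_of_lt h.2, add_zero]
    have e2 : (q * j' + u') / q = j' := by
      rw [Nat.mul_add_div hq, Nat.div_eq_of_lt h'.2, add_zero]
    have : j = j' := by rw [← e1, ← e2, h1]
    subst this
    simpa using h1
  · rw [Finset.disjoint_left]
    rintro ⟨a, b⟩ h h'
    simp only [Finset.mem_product, Finset.mem_singleton, Finset.mem_image] at h h'
    obtain ⟨_, x, _, hx⟩ := h'
    omega

/-- As `R₂` and `R₃` are graphs of functions of their last attribute, `d` determines its only path
back to `B`. It ends at `1` for `d = 0`, at `0` for block `0` and the switched blocks, and otherwise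
at some `j + 1` with `2 ≤ j + 1 ≤ m`, where `R₁` has no tuples. -/
theorem mem_pairs₁_partner_source {p r w q m : ℕ} {H : Finset ℕ} (hH : ∀ j ∈ H, 0 < j ∧ j < m)
    (hm : 0 < m) (hq : 0 < q) {a d : ℕ} :
    (d < 1 + q * m ∧ (a, partner H (source q d)) ∈ pairs₁ p r w m) ↔
      (a, d) ∈ outputPairs p r q H := by
  have h0 : 0 ∉ H := fun h => (hH 0 h).1.ne' rfl
  have himg : ∀ e : ℕ, ((1 + e) ∈ ((insert 0 H) ×ˢ Finset.range q).image
      fun x => 1 + (q * x.1 + x.2)) ↔ e / q ∈ insert 0 H := by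
    intro e
    constructor
    · intro h
      obtain ⟨⟨j, u⟩, hx, he⟩ := Finset.mem_image.1 h
      rw [Finset.mem_product, Finset.mem_range] at hx
      have : e = q * j + u := by simpa using he.symm
      rw [this, Nat.mul_add_div hq, Nat.div_eq_of_lt hx.2, add_zero]
      exact hx.1
    · intro h
      refine Finset.mem_image.2 ⟨(e / q, e % q), ?_, ?_⟩
      · rw [Finset.mem_product, Finset.mem_range]
        exact ⟨h, Nat.mod_lt _ hq⟩
      · simp only [Nat.div_add_mod]
  rcases Nat.eq_zero_or_pos d with rfl | hd
  · simp [outputPairs, source, partner, pairs₁, h0]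
    omega
  · obtain ⟨e, rfl⟩ : ∃ e, d = 1 + e := ⟨d - 1, by omega⟩
    have hr : (a, 1 + e) ∈ outputPairs p r q H ↔ a < p ∧ e / q ∈ insert 0 H := by
      rw [← himg e, outputPairs, Finset.mem_union, Finset.mem_product, Finset.mem_product]
      simp
    rw [hr, source, if_neg hd.ne', Nat.add_sub_cancel_left]
    have hlt : 1 + e < 1 + q * m ↔ e / q < m := by
      rw [Nat.div_lt_iff_lt_mul hq, mul_comm q m]; omega
    rw [hlt]
    generalize e / q = j
    by_cases hj : j = 0
    · subst hj
      simp [partner, pairs₁, h0, hm]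
    · by_cases hjH : j ∈ H
      · have e2 : (2 * j + 1) / 2 = j := by omega
        have e3 : (2 * j + 1) % 2 = 1 := by omega
        simp [partner, pairs₁, hj, hjH, e2, e3, (hH j hjH).2]
      · have e2 : (2 * j + 1) / 2 = j := by omega
        have e3 : (2 * j + 1) % 2 = 1 := by omega
        simp [partner, pairs₁, hj, hjH, e2, e3]
        omega

theorem outputSize_hardInstance {D p r w q m : ℕ} {H : Finset ℕ} (hm : 0 < m)
    (hq : 0 < q) (hH : ∀ j ∈ H, 0 < j ∧ j < m)
    (hD : (p + r + w) + 2 * m + (1 + q * m) ≤ D) :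
    (hardInstance D p r w q m H).outputSize = r + p * q * (1 + H.card) := by
  rw [← card_outputPairs p r q (fun h => (hH 0 h).1.ne' rfl),
    ← card_ofNatPairs (D := D) (Q := outputPairs p r q H), Instance.outputSize]
  · congr 1
    ext ⟨a, d⟩
    rw [mem_ofNatPairs, ← mem_pairs₁_partner_source (w := w) hH hm hq]
    simp only [Instance.queryResult, hardInstance, Finset.mem_filter, Finset.mem_univ, true_and,
      mem_ofNatPairs]
    constructor
    · rintro ⟨b, c, h1, h2, h3⟩
      simp only [pairs₂, pairs₃, Finset.mem_image, Finset.mem_range, Prod.mk.injEq] at h2 h3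
      obtain ⟨c', hc', hb, rfl⟩ := h2
      obtain ⟨d', hd', hc, rfl⟩ := h3
      rw [hc, hb]
      exact ⟨hd', h1⟩
    · rintro ⟨h1, h2⟩
      have hs := source_lt hm h1
      have hp := partner_le H hs
      refine ⟨⟨partner H (source q d), by omega⟩, ⟨source q d, by omega⟩, h2, ?_, ?_⟩
      · exact Finset.mem_image.2 ⟨_, Finset.mem_range.2 hs, rfl⟩
      · exact Finset.mem_image.2 ⟨_, Finset.mem_range.2 h1, rfl⟩
  · rintro ⟨a, d⟩ h
    rw [← mem_pairs₁_partner_source (w := w) hH hm hq] at h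
    have : a < p + r + w := by
      have := h.2
      simp [pairs₁] at this
      omega
    constructor <;> dsimp only <;> omega

/-! ### Each query depends on at most one switch -/

/-- The `i`-th pair of `pairs₂ m H` in lexicographic order. -/
def enumPairs₂ (m : ℕ) (H : Finset ℕ) (i : ℕ) : ℕ × ℕ :=
  if i < m then (0, if i ∈ H then 2 * i + 1 else 2 * i)
  else (i - m + 1, if i - m ∈ H then 2 * (i - m) else 2 * (i - m) + 1)

theorem enumPairs₂_lt {m : ℕ} (H : Finset ℕ) {i j : ℕ} (hij : i < j) :
    (enumPairs₂ m H i).1 < (enumPairs₂ m H j).1 ∨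
      (enumPairs₂ m H i).1 = (enumPairs₂ m H j).1 ∧
        (enumPairs₂ m H i).2 < (enumPairs₂ m H j).2 := by
  unfold enumPairs₂
  split_ifs <;> dsimp only <;> omega

theorem enumPairs₂_bound {m : ℕ} (H : Finset ℕ) {i : ℕ} (hi : i < 2 * m) :
    (enumPairs₂ m H i).1 ≤ m ∧ (enumPairs₂ m H i).2 < 2 * m := by
  unfold enumPairs₂
  split_ifs <;> dsimp only <;> omega

theorem mem_pairs₂ {m : ℕ} {H : Finset ℕ} {b c : ℕ} :
    (b, c) ∈ pairs₂ m H ↔ c < 2 * m ∧ b = partner H c := by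
  simp only [pairs₂, Finset.mem_image, Finset.mem_range, Prod.mk.injEq]
  constructor
  · rintro ⟨c, hc, rfl, rfl⟩
    exact ⟨hc, rfl⟩
  · rintro ⟨hc, rfl⟩
    exact ⟨c, hc, rfl, rfl⟩

theorem enumPairs₂_mem {m : ℕ} (H : Finset ℕ) {i : ℕ} (hi : i < 2 * m) :
    enumPairs₂ m H i ∈ pairs₂ m H := by
  unfold enumPairs₂
  by_cases him : i < m
  · rw [if_pos him, mem_pairs₂]
    have h2 : (2 * i + 1) / 2 = i := by omega
    have h3 : (2 * i + 1) % 2 = 1 := by omega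
    by_cases hiH : i ∈ H
    · simp [hiH, partner, h2, h3]; omega
    · simp [hiH, partner, him]
  · rw [if_neg him, mem_pairs₂]
    have h2 : (2 * (i - m) + 1) / 2 = i - m := by omega
    have h3 : (2 * (i - m) + 1) % 2 = 1 := by omega
    by_cases hiH : i - m ∈ H
    · simp [hiH, partner]; omega
    · simp [hiH, partner, h2, h3]; omega

theorem exists_enumPairs₂_eq {m : ℕ} {H : Finset ℕ} {x : ℕ × ℕ} (hx : x ∈ pairs₂ m H) :
    ∃ i < 2 * m, enumPairs₂ m H i = x := by
  obtain ⟨b, c⟩ := x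
  rw [mem_pairs₂] at hx
  obtain ⟨hc, rfl⟩ := hx
  have key : (partner H c = 0 ∧ enumPairs₂ m H (c / 2) = (0, c)) ∨
      (partner H c = c / 2 + 1 ∧ enumPairs₂ m H (m + c / 2) = (c / 2 + 1, c)) := by
    have hlt : c / 2 < m := by omega
    unfold partner enumPairs₂
    by_cases hH : c / 2 ∈ H <;> by_cases hp : c % 2 = 0 <;> simp [hH, hp, hlt] <;> omega
  rcases key with ⟨h1, h2⟩ | ⟨h1, h2⟩
  · exact ⟨c / 2, by omega, by rw [h2, h1]⟩
  · exact ⟨m + c / 2, by omega, by rw [h2, h1]⟩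

theorem enumPairs₂_fst_eq_zero {m : ℕ} {H : Finset ℕ} {i : ℕ} :
    (enumPairs₂ m H i).1 = 0 ↔ i < m := by
  unfold enumPairs₂
  split_ifs with h <;> simp [h]

/-- Positions `j` and `m + j` hold the two tuples governed by switch `j`. A switch changes their
`C`-values but not their place in the order. -/
theorem enumPairs₂_congr {m : ℕ} {H : Finset ℕ} {i : ℕ}
    (h : (if i < m then i else i - m) ∉ H) : enumPairs₂ m H i = enumPairs₂ m ∅ i := by
  unfold enumPairs₂
  split_ifs at h ⊢ <;> simp_all

theorem partner_congr {H : Finset ℕ} {c : ℕ} (h : c / 2 ∉ H) : partner H c = partner ∅ c := by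
  simp [partner, h]

section

variable {D p r w q m : ℕ} {H : Finset ℕ}

theorem mem_semijoin_hardInstance {t : PartialTuple D} {x : Tuple D} :
    x ∈ (hardInstance D p r w q m H).semijoin 1 t ↔
      (x.2.val < 2 * m ∧ x.1.val = partner H x.2.val) ∧ Matches t x := by
  simp only [Instance.semijoin, Finset.mem_filter, hardInstance, mem_ofNatPairs, mem_pairs₂]

theorem semijoin_congr_snd {t : PartialTuple D} {c : Fin D} (ht : t.2 = some c)
    (hc : c.val / 2 ∉ H) :
    (hardInstance D p r w q m H).semijoin 1 t = (hardInstance D p r w q m ∅).semijoin 1 t := by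
  ext x
  rw [mem_semijoin_hardInstance, mem_semijoin_hardInstance]
  refine and_congr_left fun hx => ?_
  have : x.2 = c := hx.2 c (by simp [ht])
  rw [this, partner_congr hc]

/-- A value `b ≠ 0` can only be the partner of `2 * (b - 1)` or `2 * (b - 1) + 1`. The value `0` is
excluded because every switch affects its semijoin; that one is handled by position. -/
theorem semijoin_congr_fst {t : PartialTuple D} {b : Fin D} (ht : t.1 = some b)
    (hb0 : b.val ≠ 0) (hb : b.val - 1 ∉ H) :
    (hardInstance D p r w q m H).semijoin 1 t = (hardInstance D p r w q m ∅).semijoin 1 t := by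
  ext x
  rw [mem_semijoin_hardInstance, mem_semijoin_hardInstance]
  refine and_congr_left fun hx => and_congr_right fun _ => ?_
  have : x.1 = b := hx.1 b (by simp [ht])
  rw [this]
  generalize b.val = b at *
  generalize x.2.val = c
  by_cases hc : c / 2 ∈ H
  · have hcb : c / 2 ≠ b - 1 := fun h => hb (h ▸ hc)
    unfold partner
    split_ifs <;> simp_all <;> omega
  · rw [partner_congr hc]

/-- Every membership query depends on at most one hidden switch. -/
theorem exists_test_congr (e : Fin 3) (x : Tuple D) :
    ∃ j₀, ∀ H : Finset ℕ, j₀ ∉ H →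
      (hardInstance D p r w q m H).test e x = (hardInstance D p r w q m ∅).test e x := by
  refine ⟨x.2.val / 2, fun H hH => ?_⟩
  have : x ∈ (hardInstance D p r w q m H).rel e ↔ x ∈ (hardInstance D p r w q m ∅).rel e := by
    fin_cases e
    · rfl
    · simp [hardInstance, mem_pairs₂, partner_congr hH]
    · rfl
  simp only [Instance.test, this]

/-- The `i`-th tuple of the second relation of the hard instance. -/
def enumTuple (D m : ℕ) [NeZero D] (H : Finset ℕ) (i : ℕ) : Tuple D :=
  (Fin.ofNat D (enumPairs₂ m H i).1, Fin.ofNat D (enumPairs₂ m H i).2)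

variable [NeZero D]

theorem enumTuple_val (hmD : 2 * m ≤ D) {i : ℕ} (hi : i < 2 * m) :
    ((enumTuple D m H i).1.val, (enumTuple D m H i).2.val) = enumPairs₂ m H i := by
  have := enumPairs₂_bound H hi
  simp only [enumTuple, Fin.val_ofNat]
  rw [Nat.mod_eq_of_lt (by omega), Nat.mod_eq_of_lt (by omega)]

theorem enumTuple_lt (hmD : 2 * m ≤ D) {i j : ℕ} (hij : i < j) (hj : j < 2 * m) :
    toLex (enumTuple D m H i) < toLex (enumTuple D m H j) := by
  rw [Prod.Lex.toLex_lt_toLex, Fin.lt_def, Fin.lt_def, Fin.ext_iff]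
  have h1 := enumTuple_val (D := D) (H := H) hmD (hij.trans hj)
  have h2 := enumTuple_val (D := D) (H := H) hmD hj
  have := enumPairs₂_lt (m := m) H hij
  rw [← h1, ← h2] at this
  exact this

theorem mem_semijoin_none (hmD : 2 * m ≤ D) (x : Tuple D) :
    x ∈ (hardInstance D p r w q m H).semijoin 1 (none, none) ↔
      ∃ i < 2 * m, enumTuple D m H i = x := by
  rw [Instance.semijoin_none]
  simp only [hardInstance, mem_ofNatPairs]
  constructor
  · intro hx
    obtain ⟨i, hi, hix⟩ := exists_enumPairs₂_eq hx
    refine ⟨i, hi, ?_⟩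
    rw [← enumTuple_val (D := D) hmD hi, Prod.mk.injEq] at hix
    exact Prod.ext (Fin.ext hix.1) (Fin.ext hix.2)
  · rintro ⟨i, hi, rfl⟩
    rw [enumTuple_val hmD hi]
    exact enumPairs₂_mem H hi

theorem mem_semijoin_zero (hmD : 2 * m ≤ D) {b : Fin D} (hb : b.val = 0) (x : Tuple D) :
    x ∈ (hardInstance D p r w q m H).semijoin 1 (some b, none) ↔
      ∃ i < m, enumTuple D m H i = x := by
  have h1 : x ∈ (hardInstance D p r w q m H).semijoin 1 (some b, none) ↔
      x ∈ (hardInstance D p r w q m H).semijoin 1 (none, none) ∧ x.1.val = 0 := by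
    rw [← hb, ← Fin.ext_iff]
    simp [Instance.semijoin, Matches]
  rw [h1, mem_semijoin_none hmD]
  constructor
  · rintro ⟨⟨i, hi, rfl⟩, h0⟩
    refine ⟨i, ?_, rfl⟩
    have := enumTuple_val (D := D) (H := H) hmD hi
    rw [← enumPairs₂_fst_eq_zero (H := H), ← this]
    exact h0
  · rintro ⟨i, hi, rfl⟩
    have hi' : i < 2 * m := by omega
    refine ⟨⟨i, hi', rfl⟩, ?_⟩
    have := enumTuple_val (D := D) (H := H) hmD hi'
    rw [← enumPairs₂_fst_eq_zero (H := H), ← this] at hi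
    exact hi

/-- Every degree query depends on at most one hidden switch. -/
theorem exists_degree_congr (hmD : 2 * m ≤ D) (e : Fin 3) (t : PartialTuple D) :
    ∃ j₀, ∀ H : Finset ℕ, j₀ ∉ H →
      (hardInstance D p r w q m H).degree e t = (hardInstance D p r w q m ∅).degree e t := by
  by_cases he : e = 1
  · subst he
    obtain ⟨b, c⟩ := t
    rcases c with _ | c
    · rcases b with _ | b
      · refine ⟨0, fun H _ => ?_⟩
        rw [Instance.degree_eq_of_enum _ _ _ _ _ (fun _ _ => enumTuple_lt hmD)
            (mem_semijoin_none hmD),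
          Instance.degree_eq_of_enum _ _ _ _ _ (fun _ _ => enumTuple_lt hmD)
            (mem_semijoin_none hmD)]
      · by_cases hb : b.val = 0
        · refine ⟨0, fun H _ => ?_⟩
          rw [Instance.degree_eq_of_enum _ _ _ _ _
              (fun _ _ h h' => enumTuple_lt hmD h (by omega)) (mem_semijoin_zero hmD hb),
            Instance.degree_eq_of_enum _ _ _ _ _
              (fun _ _ h h' => enumTuple_lt hmD h (by omega)) (mem_semijoin_zero hmD hb)]
        · refine ⟨b.val - 1, fun H hH => ?_⟩
          rw [Instance.degree, Instance.degree, semijoin_congr_fst rfl hb hH]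
    · refine ⟨c.val / 2, fun H hH => ?_⟩
      rw [Instance.degree, Instance.degree, semijoin_congr_snd rfl hH]
  · refine ⟨0, fun H _ => ?_⟩
    have : (hardInstance D p r w q m H).rel e = (hardInstance D p r w q m ∅).rel e := by
      fin_cases e <;> simp_all [hardInstance]
    rw [Instance.degree, Instance.degree, Instance.semijoin, Instance.semijoin, this]

/-- Every neighbor query depends on at most one hidden switch. -/
theorem exists_neighbor_congr (hmD : 2 * m ≤ D) (e : Fin 3) (t : PartialTuple D) (j : ℕ) :
    ∃ j₀, ∀ H : Finset ℕ, j₀ ∉ H →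
      (hardInstance D p r w q m H).neighbor e t j =
        (hardInstance D p r w q m ∅).neighbor e t j := by
  by_cases he : e = 1
  · subst he
    obtain ⟨b, c⟩ := t
    rcases c with _ | c
    · rcases b with _ | b
      · refine ⟨if j < m then j else j - m, fun H hH => ?_⟩
        rw [Instance.neighbor_eq_of_enum _ _ _ _ _ (fun _ _ => enumTuple_lt hmD)
            (mem_semijoin_none hmD),
          Instance.neighbor_eq_of_enum _ _ _ _ _ (fun _ _ => enumTuple_lt hmD)
            (mem_semijoin_none hmD), enumTuple, enumTuple, enumPairs₂_congr hH]
      · by_cases hb : b.val = 0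
        · refine ⟨if j < m then j else j - m, fun H hH => ?_⟩
          rw [Instance.neighbor_eq_of_enum _ _ _ _ _
              (fun _ _ h h' => enumTuple_lt hmD h (by omega)) (mem_semijoin_zero hmD hb),
            Instance.neighbor_eq_of_enum _ _ _ _ _
              (fun _ _ h h' => enumTuple_lt hmD h (by omega)) (mem_semijoin_zero hmD hb),
            enumTuple, enumTuple, enumPairs₂_congr hH]
        · refine ⟨b.val - 1, fun H hH => ?_⟩
          rw [Instance.neighbor, Instance.neighbor, semijoin_congr_fst rfl hb hH]
    · refine ⟨c.val / 2, fun H hH => ?_⟩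
      rw [Instance.neighbor, Instance.neighbor, semijoin_congr_snd rfl hH]
  · refine ⟨0, fun H _ => ?_⟩
    have : (hardInstance D p r w q m H).rel e = (hardInstance D p r w q m ∅).rel e := by
      fin_cases e <;> simp_all [hardInstance]
    rw [Instance.neighbor, Instance.neighbor, Instance.semijoin, Instance.semijoin, this]

theorem card_rel_hardInstance (hmD : 2 * m ≤ D) (e : Fin 3) :
    (hardInstance D p r w q m H).degree e (none, none) =
      (hardInstance D p r w q m ∅).degree e (none, none) := by
  fin_cases e
  · rfl
  · change Instance.degree _ 1 _ = Instance.degree _ 1 _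
    rw [Instance.degree_eq_of_enum _ _ _ _ _ (fun _ _ => enumTuple_lt hmD)
        (mem_semijoin_none hmD),
      Instance.degree_eq_of_enum _ _ _ _ _ (fun _ _ => enumTuple_lt hmD)
        (mem_semijoin_none hmD)]
  · rfl

/-- The one switch on which a query depends lies in at most one of the disjoint sets `G a`. -/
theorem almostAgree_hardInstance (hmD : 2 * m ≤ D) {ι : Type*} (G : ι → Finset ℕ)
    (hG : Pairwise (Function.onFun Disjoint G)) :
    (hardInstance D p r w q m ∅).AlmostAgree fun a => hardInstance D p r w q m (G a) := by
  have key : ∀ {β : Type} (f : Finset ℕ → β), (∃ j₀, ∀ H : Finset ℕ, j₀ ∉ H → f H = f ∅) →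
      {a | f (G a) ≠ f ∅}.Subsingleton := by
    rintro β f ⟨j₀, h⟩ a ha a' ha'
    by_contra hne
    have h1 : j₀ ∈ G a := by_contra fun hn => ha (h _ hn)
    have h2 : j₀ ∈ G a' := by_contra fun hn => ha' (h _ hn)
    exact Finset.disjoint_left.1 (hG hne) h1 h2
  exact
    { degree := fun e t => key (fun H => (hardInstance D p r w q m H).degree e t)
        (exists_degree_congr hmD e t)
      card := fun a e => card_rel_hardInstance hmD e
      neighbor := fun e t j => key (fun H => (hardInstance D p r w q m H).neighbor e t j)
        (exists_neighbor_congr hmD e t j)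
      test := fun e x => key (fun H => (hardInstance D p r w q m H).test e x)
        (exists_test_congr e x) }

end

/-! ### Parameters, and separation of the output sizes -/

/-- Parameters of a hard instance with input size `N`, output size `OUT` and room for
`Ω(min {N, N² / OUT})` switches, each of which adds a constant fraction of `OUT` to the output. -/
theorem exists_parameters {N OUT : ℕ} (hOUT : 0 < OUT) (hN : 10000 ≤ N)
    (hNO : 10000 * OUT ≤ N ^ 2) :
    ∃ p r w q n : ℕ, 0 < q ∧ r + p * q = OUT ∧ OUT ≤ 2 * (p * q) ∧
      (p + r + w) + 2 * (n + 1) + (1 + q * (n + 1)) = N ∧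
      min (N : ℝ) ((N : ℝ) ^ 2 / OUT) ≤ 300 * n := by
  -- With `p`, `r`, `n` and `q * n` all at most `L`, a sixteenth of `N` leaves room for every part;
  -- `w` fills up the rest.
  obtain ⟨L, hL⟩ : ∃ L, L = N / 16 := ⟨_, rfl⟩
  have hL1 : 16 * L ≤ N := by omega
  have hL2 : N ≤ 17 * L := by omega
  by_cases hcase : OUT ≤ L
  · refine ⟨OUT, 0, N - (OUT + 2 * (L + 1) + (1 + (L + 1))), 1, L, one_pos, by omega, by omega,
      by omega, (min_le_left _ _).trans ?_⟩
    exact_mod_cast (by omega : N ≤ 300 * L)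
  · have hLpos : 0 < L := by omega
    obtain ⟨q, hq⟩ : ∃ q, q = OUT / L := ⟨_, rfl⟩
    have hqpos : 0 < q := hq ▸ Nat.div_pos (by omega) hLpos
    have hdm : L * q + OUT % L = OUT := by rw [hq]; exact Nat.div_add_mod _ _
    have hr : OUT % L < L := Nat.mod_lt _ hLpos
    have hLq : L ≤ L * q := Nat.le_mul_of_pos_right _ hqpos
    obtain ⟨n, hn⟩ : ∃ n, n = L / q := ⟨_, rfl⟩
    have hnq : q * n ≤ L := by rw [hn]; exact Nat.mul_div_le _ _
    have hnL : n ≤ L := hn ▸ Nat.div_le_self _ _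
    have hLn : L < q * (n + 1) := by rw [hn]; exact Nat.lt_mul_div_succ _ hqpos
    have hN2 : N ^ 2 ≤ 289 * (L * L) := by
      calc N ^ 2 ≤ (17 * L) ^ 2 := Nat.pow_le_pow_left hL2 2
        _ = 289 * (L * L) := by ring
    -- Here `10000 * OUT ≤ N ^ 2 ≤ 289 * L ^ 2` gives `OUT ≤ L ^ 2`.
    have hqL : q ≤ L := le_of_mul_le_mul_left (by omega : L * q ≤ L * L) hLpos
    refine ⟨L, OUT % L, N - (L + OUT % L + 2 * (n + 1) + (1 + q * (n + 1))), q, n, hqpos,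
      by omega, by omega, ?_, (min_le_right _ _).trans ?_⟩
    · have : q * (n + 1) = q * n + q := by ring
      omega
    · rw [div_le_iff₀ (by exact_mod_cast hOUT)]
      have h1 : L * L ≤ OUT * n + OUT := by
        calc L * L ≤ L * (q * (n + 1)) := Nat.mul_le_mul_left _ hLn.le
          _ = L * q * (n + 1) := by ring
          _ ≤ OUT * (n + 1) := Nat.mul_le_mul_right _ (by omega)
          _ = OUT * n + OUT := by ring
      -- The surplus `289 * OUT` is at most `0.0289 * N ^ 2`, which raises the constant from `289`
      -- to less than `300`.
      have h2 : N ^ 2 ≤ 300 * n * OUT := by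
        rw [mul_assoc, mul_comm n OUT]
        omega
      exact_mod_cast h2

theorem pairwise_disjoint_blocks (h S : ℕ) :
    Pairwise (Function.onFun Disjoint
      fun a : Fin S => Finset.Ico (1 + h * a.val) (1 + h * a.val + h)) := by
  intro a b hab
  rw [Function.onFun, Finset.disjoint_left]
  intro x hx hx'
  rw [Finset.mem_Ico] at hx hx'
  refine hab (Fin.ext ?_)
  rcases lt_trichotomy a.val b.val with hlt | heq | hlt
  · have : h * (a.val + 1) ≤ h * b.val := Nat.mul_le_mul_left _ hlt
    rw [mul_add] at this
    omega
  · exact heq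
  · have : h * (b.val + 1) ≤ h * a.val := Nat.mul_le_mul_left _ hlt
    rw [mul_add] at this
    omega

theorem disjoint_approxEvent {ε V V' : ℝ} (h : (1 + ε) * V < (1 - ε) * V') :
    Disjoint (Algorithm.approxEvent ε V) (Algorithm.approxEvent ε V') := by
  rw [Set.disjoint_left]
  rintro _ ⟨v, rfl, hv⟩ ⟨v', hvv, hv'⟩
  obtain rfl : v = v' := by simpa using hvv
  exact (hv'.1.trans hv.2).not_gt h

/-- Since `OUT ≤ 2 * P` and `g ≥ 1`, the smaller output size is at most `4 * (P * g)`, so growth of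
`g` by the factor `B` outweighs `(1 + ε) / (1 - ε)`. -/
theorem approx_gap {ε B OUT P g g' : ℝ} (hε0 : 0 < ε) (hε1 : ε < 1) (hOUT : 0 < OUT)
    (hP' : OUT ≤ 2 * P) (hB : 4 * (1 + ε) < B * (1 - ε)) (hg : 1 ≤ g)
    (hgg : B * g ≤ g') :
    (1 + ε) * (OUT + P * g) < (1 - ε) * (OUT + P * g') := by
  have hε : 0 < 1 - ε := by linarith
  have hP0 : 0 < P := by linarith
  calc (1 + ε) * (OUT + P * g) ≤ (1 + ε) * (4 * (P * g)) := by
        refine mul_le_mul_of_nonneg_left ?_ (by linarith)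
        nlinarith
    _ = 4 * (1 + ε) * (P * g) := by ring
    _ < B * (1 - ε) * (P * g) := mul_lt_mul_of_pos_right hB (by positivity)
    _ = (1 - ε) * (P * (B * g)) := by ring
    _ ≤ (1 - ε) * (OUT + P * g') := by
        refine mul_le_mul_of_nonneg_left ?_ hε.le
        have := mul_le_mul_of_nonneg_left hgg hP0.le
        linarith

/-- An algorithm that is likely to have stopped early on the instance without switches returns an
approximation of the output size with `h` switches with a probability bounded from below. -/
theorem le_approx_hardInstance {D p r w q n h t : ℕ} (𝒜 : Algorithm D) (hq : 0 < q) {ε η : ℝ} (hη : 0 < η)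
    (hD : (p + r + w) + 2 * (n + 1) + (1 + q * (n + 1)) ≤ D)
    (hsucc : ∀ I : Instance D, I.inputSize = (p + r + w) + 2 * (n + 1) + (1 + q * (n + 1)) →
      I.outputSize = r + p * q * (1 + h) → ENNReal.ofReal (4 * η) ≤ 𝒜.successProb I ε)
    (hS : 0 < n / h) (ht : (t : ℝ) ≤ η * (n / h : ℕ))
    (hrun : 𝒜.probRunningAfter (hardInstance D p r w q (n + 1) ∅) t ≤ ENNReal.ofReal η) :
    ENNReal.ofReal (2 * η) ≤ (𝒜.run (hardInstance D p r w q (n + 1) ∅) t).toOuterMeasure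
      (Algorithm.approxEvent ε (r + p * q * (1 + h) : ℕ)) := by
  have : NeZero D := ⟨by omega⟩
  set S := n / h with hSdef
  have hblock : ∀ (a : Fin S), ∀ j ∈ Finset.Ico (1 + h * a.val) (1 + h * a.val + h),
      0 < j ∧ j < n + 1 := by
    intro a j hj
    rw [Finset.mem_Ico] at hj
    have h1 : h * (a.val + 1) ≤ h * S := Nat.mul_le_mul_left _ a.isLt
    have h2 : h * S ≤ n := Nat.mul_div_le _ _
    rw [mul_add] at h1
    omega
  have hout : ∀ a : Fin S, (hardInstance D p r w q (n + 1)
      (Finset.Ico (1 + h * a.val) (1 + h * a.val + h))).outputSize = r + p * q * (1 + h) := by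
    intro a
    rw [outputSize_hardInstance n.succ_pos hq (hblock a) hD]
    simp
  have key := 𝒜.le_run_of_almostAgree
    (almostAgree_hardInstance (p := p) (r := r) (w := w) (q := q) (by omega : 2 * (n + 1) ≤ D)
      (fun a : Fin S => Finset.Ico (1 + h * a.val) (1 + h * a.val + h))
      (pairwise_disjoint_blocks h S)) hout
    (fun a => hsucc _ (inputSize_hardInstance _ n.succ_pos hD) (hout a)) t
  rw [Fintype.card_fin] at key
  generalize (𝒜.run (hardInstance D p r w q (n + 1) ∅) t).toOuterMeasure
    (Algorithm.approxEvent ε (r + p * q * (1 + h) : ℕ)) = x at *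
  generalize 𝒜.probRunningAfter (hardInstance D p r w q (n + 1) ∅) t = y at *
  have ht' : (t : ℝ≥0∞) ≤ S * ENNReal.ofReal η := by
    rw [← ENNReal.ofReal_natCast, ← ENNReal.ofReal_natCast, ← ENNReal.ofReal_mul (by positivity)]
    exact ENNReal.ofReal_le_ofReal (by linarith)
  -- Of the success probability `4 * η`, one `η` is lost to runs that have not stopped and one to
  -- the hybrid error `t / S`.
  have h1 : (S : ℝ≥0∞) * ENNReal.ofReal (4 * η) ≤ S * (x + ENNReal.ofReal (2 * η)) := by
    refine key.trans ?_
    rw [show 2 * η = η + η by ring, ENNReal.ofReal_add hη.le hη.le, ← add_assoc,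
      mul_add (S : ℝ≥0∞) (x + _)]
    gcongr
  have h2 := (ENNReal.mul_le_mul_iff_right (by exact_mod_cast hS.ne') (by simp)).1 h1
  rw [show 4 * η = 2 * η + 2 * η by ring, ENNReal.ofReal_add (by linarith) (by linarith)] at h2
  exact (ENNReal.add_le_add_iff_right ENNReal.ofReal_ne_top).1 h2

end ChainCount

/-! ### The lower bound -/

theorem mainTheorem10 (ε δ : ℝ) (hε0 : 0 < ε) (hε1 : ε < 1) (hδ0 : 0 < δ) (hδ1 : δ < 1) :
    ∃ c : ℝ, 0 < c ∧ ∃ K : ℕ,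
      ∀ N OUT D : ℕ, 0 < N → 0 < OUT → N ≤ D →
        (∃ I : ChainCount.Instance D, I.inputSize = N ∧ I.outputSize = OUT) →
        ∀ 𝒜 : ChainCount.Algorithm D,
          (∀ I : ChainCount.Instance D, I.inputSize = N →
            OUT ≤ I.outputSize → I.outputSize ≤ K * OUT →
            ENNReal.ofReal (1 - δ) ≤ 𝒜.successProb I ε) →
          ∃ I : ChainCount.Instance D, I.inputSize = N ∧ I.outputSize = OUT ∧
            ∀ t : ℕ, (t : ℝ) < c * min (N : ℝ) ((N : ℝ) ^ 2 / (OUT : ℝ)) →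
              ENNReal.ofReal c ≤ 𝒜.probRunningAfter I t := by
  obtain ⟨η, hη⟩ : ∃ η, η = (1 - δ) / 4 := ⟨_, rfl⟩
  have hη0 : 0 < η := by rw [hη]; linarith
  have hη1 : η < 1 := by rw [hη]; linarith
  -- `M` events of probability `2 * η` overfill the probability space; `B` is the separation ratio
  -- of `approx_gap`.
  obtain ⟨M, hM⟩ := exists_nat_gt (1 / (2 * η))
  obtain ⟨B, hB⟩ := exists_nat_gt (4 * (1 + ε) / (1 - ε))
  rw [div_lt_iff₀ (by linarith)] at hB hM
  have hBpos : 0 < B := by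
    rcases Nat.eq_zero_or_pos B with rfl | h
    · norm_num at hB; linarith
    · exact h
  have hBM : (1 : ℝ) ≤ (B ^ M : ℕ) := by exact_mod_cast Nat.one_le_pow _ _ hBpos
  obtain ⟨c, hc⟩ : ∃ c : ℝ, c = η / (10000 * (B ^ M : ℕ)) := ⟨_, rfl⟩
  have hc0 : 0 < c := by rw [hc]; positivity
  have hcB : c * (10000 * (B ^ M : ℕ)) = η := by rw [hc]; field_simp
  have hcη : 10000 * c ≤ η := by nlinarith
  -- At most `B ^ M` switches are turned on, each adding `p * q ≤ OUT`.
  refine ⟨c, hc0, 1 + B ^ M, ?_⟩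
  intro N OUT D hN hOUT hND hex 𝒜 hA
  have hOUT' : (0 : ℝ) < OUT := by exact_mod_cast hOUT
  set T := min (N : ℝ) ((N : ℝ) ^ 2 / OUT) with hT
  -- Here only `t = 0` is below the bound, and at time `0` every algorithm is running. Otherwise `T`
  -- exceeds the constants used below.
  by_cases hsmall : c * T ≤ 1
  · obtain ⟨I, hI1, hI2⟩ := hex
    refine ⟨I, hI1, hI2, fun t ht => ?_⟩
    have ht0 : t = 0 := by
      have : (t : ℝ) < 1 := ht.trans_le hsmall
      exact Nat.lt_one_iff.1 (by exact_mod_cast this)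
    subst ht0
    have : 𝒜.probRunningAfter I 0 = 1 := by
      simp [ChainCount.Algorithm.probRunningAfter, ChainCount.Algorithm.run,
        ChainCount.Algorithm.runFrom]
    rw [this]
    exact ENNReal.ofReal_le_one.2 (by linarith)
  push Not at hsmall
  have hT0 : 0 < T := pos_of_mul_pos_right (one_pos.trans hsmall) hc0.le
  have hTB : 10000 * ((B ^ M : ℕ) : ℝ) ≤ T := by
    by_contra! hlt
    have := mul_lt_mul_of_pos_left hlt hc0
    linarith
  have hT1 : 10000 ≤ T := by linarith
  have hN1 : 10000 ≤ N := by exact_mod_cast hT1.trans (min_le_left _ _)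
  have hNO : 10000 * OUT ≤ N ^ 2 := by
    have := hT1.trans (min_le_right _ _)
    rw [le_div_iff₀ hOUT'] at this
    exact_mod_cast this
  obtain ⟨p, r, w, q, n, hq, hpq, hpq2, hsum, hTn⟩ :=
    ChainCount.exists_parameters hOUT hN1 hNO
  have hD := hsum.trans_le hND
  refine ⟨ChainCount.hardInstance D p r w q (n + 1) ∅, ?_, ?_, ?_⟩
  · rw [ChainCount.inputSize_hardInstance _ n.succ_pos hD, hsum]
  · rw [ChainCount.outputSize_hardInstance n.succ_pos hq (by simp) hD]
    simpa using hpq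
  intro t ht
  by_contra! hrun
  have hlow : ∀ i : Fin M, ENNReal.ofReal (2 * η) ≤
      (𝒜.run (ChainCount.hardInstance D p r w q (n + 1) ∅) t).toOuterMeasure
        (ChainCount.Algorithm.approxEvent ε (r + p * q * (1 + B ^ i.val) : ℕ)) := by
    intro i
    have hh : 0 < B ^ i.val := pow_pos hBpos _
    have hhM : B ^ i.val ≤ B ^ M := Nat.pow_le_pow_right hBpos i.isLt.le
    have hhM' : ((B ^ i.val : ℕ) : ℝ) ≤ (B ^ M : ℕ) := by exact_mod_cast hhM
    have hh' : (0 : ℝ) < (B ^ i.val : ℕ) := by exact_mod_cast hh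
    have hnS : (n : ℝ) ≤ (B ^ i.val : ℕ) * ((n / B ^ i.val : ℕ) + 1) := by
      exact_mod_cast (Nat.lt_mul_div_succ n hh).le
    generalize B ^ i.val = h at *
    -- Rounding `n / h` down costs at most `300 * h ≤ 300 * B ^ M`, which is at most `0.03 * T`.
    have hTS : T ≤ 400 * h * (n / h : ℕ) := by linarith
    have hS : 0 < n / h := by
      by_contra! h0
      rw [Nat.le_zero.1 h0] at hTS
      norm_num at hTS
      linarith
    refine ChainCount.le_approx_hardInstance 𝒜 hq hη0 hD ?_ hS ?_
      (hrun.le.trans (ENNReal.ofReal_le_ofReal (by linarith)))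
    · intro I hI1 hI2
      rw [show 4 * η = 1 - δ by rw [hη]; ring]
      have hP : p * q ≤ OUT := by omega
      refine hA I (hI1.trans hsum) ?_ ?_
      · rw [hI2, mul_add]; omega
      · rw [hI2]
        calc r + p * q * (1 + h) = OUT + p * q * h := by rw [← hpq]; ring
          _ ≤ OUT + OUT * B ^ M := by gcongr
          _ = (1 + B ^ M) * OUT := by ring
    · have hS0 : (0 : ℝ) ≤ (n / h : ℕ) := Nat.cast_nonneg _
      calc (t : ℝ) ≤ c * T := ht.le
        _ ≤ c * (400 * h * (n / h : ℕ)) := mul_le_mul_of_nonneg_left hTS hc0.le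
        _ ≤ c * (10000 * (B ^ M : ℕ) * (n / h : ℕ)) := by gcongr; norm_num
        _ = η * (n / h : ℕ) := by rw [← mul_assoc, hcB]
  have hgap : ∀ i j : Fin M, i < j → Disjoint
      (ChainCount.Algorithm.approxEvent ε (r + p * q * (1 + B ^ i.val) : ℕ))
      (ChainCount.Algorithm.approxEvent ε (r + p * q * (1 + B ^ j.val) : ℕ)) := by
    intro i j hij
    refine ChainCount.disjoint_approxEvent ?_
    have hcast : ∀ k : ℕ, ((r + p * q * (1 + k) : ℕ) : ℝ) = OUT + ((p * q : ℕ) : ℝ) * k := by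
      intro k
      rw [← hpq]
      push_cast
      ring
    rw [hcast, hcast]
    refine ChainCount.approx_gap hε0 hε1 hOUT' ?_ hB ?_ ?_
    · exact_mod_cast hpq2
    · exact_mod_cast Nat.one_le_pow _ _ hBpos
    · have : B * B ^ i.val ≤ B ^ j.val := by
        rw [← pow_succ']
        exact Nat.pow_le_pow_right hBpos hij
      exact_mod_cast this
  have hone := ChainCount.Algorithm.sum_toOuterMeasure_le_one
    (𝒜.run (ChainCount.hardInstance D p r w q (n + 1) ∅) t)
    (fun i : Fin M =>
      ChainCount.Algorithm.approxEvent ε (r + p * q * (1 + B ^ i.val) : ℕ))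
    (fun i j hij => hij.lt_or_gt.elim (hgap i j) fun h => (hgap j i h).symm)
  have hsumlow := (Finset.sum_le_sum fun i (_ : i ∈ Finset.univ) => hlow i).trans hone
  rw [Finset.sum_const, Finset.card_univ, Fintype.card_fin, nsmul_eq_mul,
    ← ENNReal.ofReal_natCast, ← ENNReal.ofReal_mul (Nat.cast_nonneg _),
    ENNReal.ofReal_le_one] at hsumlow
  linarith
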